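/- **Language.** Terms over a type $\alpha$ of states are generated by $\mathsf{skip}$, $\mathsf{basic}\,f$ ($f:\alpha\to\alpha$), $\mathsf{cjump}\ C\ \mathsf{to}\ i\ \mathsf{otherwise}\ p$ ($i\in\mathbb N$), $\mathsf{while}\ C\ \mathsf{do}\ p\ \mathsf{subsequently}\ q$, $\mathsf{if}\ C\ \mathsf{then}\ p\ \mathsf{else}\ q$, $p;q$ (associating to the right), $\parallel(p_1,\dots,p_m)$ with $m>0$, and $\mathsf{await}\ C\ \mathsf{do}\ p$, where $C\subseteq\alpha$. Given a code retrieving function $\rho$ from $\mathbb N$ to terms, the program steps $\to_P$ on configurations $(p,\sigma)$ are the least relation with: $(\mathsf{basic}\,f,\sigma)\to(\mathsf{skip},f\sigma)$; a $\mathsf{cjump}$ goes to $(\rho\,i,\sigma)$ if $\sigma\in C$ and to $(p,\sigma)$ otherwise; a conditional goes to $(p,\sigma)$ if $\sigma\in C$ and to $(q,\sigma)$ otherwise; $x=\mathsf{while}\ C\ \mathsf{do}\ p\ \mathsf{subsequently}\ q$ goes to $(p;\mathsf{skip};x,\sigma)$ if $\sigma\in C$ and to $(q,\sigma)$ otherwise;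 $(\mathsf{await}\ C\ \mathsf{do}\ p,\sigma)\to(\mathsf{skip},\sigma')$ if $\sigma\in C$ and $(p,\sigma)\to_P^*(\mathsf{skip},\sigma')$; $(p;q,\sigma)\to(p';q,\sigma')$ if $(p,\sigma)\to(p',\sigma')$; $(\mathsf{skip};q,\sigma)\to(q,\sigma)$; a parallel composition steps by a step of one of its components, and goes to $(\mathsf{skip},\sigma)$ when all components are $\mathsf{skip}$. Environment steps $(p,\sigma)\to_E(p,\sigma')$ change the state arbitrarily. $\mathsf{while}\ C\ \mathsf{do}\ p$ abbreviates $\mathsf{while}\ C\ \mathsf{do}\ p\ \mathsf{subsequently}\ \mathsf{skip}$, and an assignment is a $\mathsf{basic}$ update of one variable. **Triples.** $\rho\models\{R,P\}\,p\,\{Q,G\}$ holds iff, for every finite non-empty sequence of configurations that starts with program part $p$, whose consecutive members are related by a program or an environment step, whose environment steps all have their states related by $R$, and whose initial state satisfies $P$: the state of the first configuration with program part $\mathsf{skip}$ (if there is one) satisfies $Q$, and all program steps have their states related by $G$. **Correspondence.** $p\sqsupseteq_r q$ (w.r.t. $\rho$ on both sides) iff some relation $X$ on terms contains $(p,q)$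 and satisfies: if $(u,v)\in X$, $(\sigma_1,\sigma_2)\in r$ and $(v,\sigma_2)\to_P(v',\sigma_2')$, then $(u,\sigma_1)\to_P(u',\sigma_1')$ for some $(u',v')\in X$ and $(\sigma_1',\sigma_2')\in r$; if $(\mathsf{skip},v)\in X$ then $v=\mathsf{skip}$; if $(u,\mathsf{skip})\in X$ then $u=\mathsf{skip}$. **States.** A state assigns Boolean values to $flag_0,flag_1,turn,turn\_aux_0,turn\_aux_1$ and values of arbitrary fixed types to $shared,local_0,local_1$. Primed variables refer to the second state of a relation. Let $$cond_0 = flag_0\wedge(\neg turn\_aux_1\vee\neg flag_1\vee\neg turn),\qquad cond_1 = flag_1\wedge(\neg turn\_aux_0\vee\neg flag_0\vee turn),$$ $$r_i=\{(\sigma,\sigma)\mid \sigma\text{ satisfies } turn\_aux_i\wedge cond_i\}\quad(i=0,1),$$ and let $r_{eqv}$ be the relation of agreeing on $flag_0,flag_1,turn,shared,local_0,local_1$. The threads are $$thread_0\,cs = flag_0:=\mathrm{True};\ turn:=\mathrm{True};\ \mathsf{while}\ flag_1\wedge turn\ \mathsf{do}\ \mathsf{skip};\ cs;\ flag_0:=\mathrm{False},$$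 $$thread_1\,cs = flag_1:=\mathrm{True};\ turn:=\mathrm{False};\ \mathsf{while}\ flag_0\wedge\neg turn\ \mathsf{do}\ \mathsf{skip};\ cs;\ flag_1:=\mathrm{False}.$$ **Proposition (safety of Peterson's mutex).** Let $\rho$ be a code retrieving function (irrelevant if $cs_0,cs_1$ contain no jumps), let $cs_0,cs_1$ be terms over these states and $P_0,Q_0,P_1,Q_1$ predicates on the values of $shared$. For $\{i,j\}=\{0,1\}$ let $G_i$ be the relation $$flag_0=flag_0'\wedge flag_1=flag_1'\wedge turn=turn'\wedge local_j=local_j'\wedge turn\_aux_0=turn\_aux_0'\wedge turn\_aux_1=turn\_aux_1'$$ $$\wedge\ (P_j\,shared\to P_j\,shared')\wedge(Q_j\,shared\to Q_j\,shared').$$ Assume 1. $\rho\models\{shared=shared'\wedge local_0=local_0',\ P_0\,shared\}\ cs_0\ \{Q_0\,shared,\ G_0\}$, 2. $\rho\models\{shared=shared'\wedge local_1=local_1',\ P_1\,shared\}\ cs_1\ \{Q_1\,shared,\ G_1\}$, 3. $cs_0\sqsupseteq_{r_0}cs_0$, 4. $cs_1\sqsupseteq_{r_1}cs_1$, 5.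 $cs_0\sqsupseteq_{r_{eqv}}cs_0$, 6. $cs_1\sqsupseteq_{r_{eqv}}cs_1$. Then $$\rho\models\{\mathrm{id},\ P_0\,shared\wedge P_1\,shared\}\ \ thread_0\,cs_0\parallel thread_1\,cs_1\ \ \{Q_0\,shared\wedge Q_1\,shared,\ \top\}.$$ -/

import Mathlib

universe u v w

/-- Terms of the generic concurrent imperative language over a type `α` of states.
State transformers and state predicates are embedded shallowly; labels are natural numbers.
`par` takes a finite non-empty sequence of terms. -/
inductive Lang (α : Type u) : Type u
  | skip : Lang α
  | basic (f : α → α) : Lang α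
  | cjump (C : Set α) (i : ℕ) (p : Lang α) : Lang α
  | whileDo (C : Set α) (p q : Lang α) : Lang α
  | ite (C : Set α) (p q : Lang α) : Lang α
  | seq (p q : Lang α) : Lang α
  | par {m : ℕ} (p : Fin (m + 1) → Lang α) : Lang α
  | await (C : Set α) (p : Lang α) : Lang α

namespace Lang

/-- `while C do p`, that is, the while-statement with continuation `skip`. -/
def whileS {α : Type u} (C : Set α) (p : Lang α) : Lang α := whileDo C p skip

/-- The binary parallel composition `p ∥ q`. -/
def par2 {α : Type u} (p q : Lang α) : Lang α := par ![p, q]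

end Lang

/-- A configuration: a program part and a state part. -/
abbrev Config (α : Type u) : Type u := Lang α × α

mutual

/-- Program steps in the context of the code retrieving function `ρ`. -/
inductive PStep {α : Type u} (ρ : ℕ → Lang α) : Config α → Config α → Prop
  | basic (f : α → α) (σ : α) : PStep ρ (.basic f, σ) (.skip, f σ)
  | cjump_true (C : Set α) (i : ℕ) (p : Lang α) (σ : α) (h : σ ∈ C) :
      PStep ρ (.cjump C i p, σ) (ρ i, σ)
  | cjump_false (C : Set α) (i : ℕ) (p : Lang α) (σ : α) (h : σ ∉ C) :
      PStep ρ (.cjump C i p, σ) (p, σ)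
  | await (C : Set α) (p : Lang α) (σ τ : α) (h : σ ∈ C)
      (hp : PSteps ρ (p, σ) (.skip, τ)) :
      PStep ρ (.await C p, σ) (.skip, τ)
  | ite_true (C : Set α) (p q : Lang α) (σ : α) (h : σ ∈ C) :
      PStep ρ (.ite C p q, σ) (p, σ)
  | ite_false (C : Set α) (p q : Lang α) (σ : α) (h : σ ∉ C) :
      PStep ρ (.ite C p q, σ) (q, σ)
  | while_true (C : Set α) (p q : Lang α) (σ : α) (h : σ ∈ C) :
      PStep ρ (.whileDo C p q, σ) (.seq p (.seq .skip (.whileDo C p q)), σ)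
  | while_false (C : Set α) (p q : Lang α) (σ : α) (h : σ ∉ C) :
      PStep ρ (.whileDo C p q, σ) (q, σ)
  | seq (p₁ p₂ q : Lang α) (σ τ : α) (h : PStep ρ (p₁, σ) (p₂, τ)) :
      PStep ρ (.seq p₁ q, σ) (.seq p₂ q, τ)
  | seq_skip (q : Lang α) (σ : α) : PStep ρ (.seq .skip q, σ) (q, σ)
  | par {m : ℕ} (p : Fin (m + 1) → Lang α) (k : Fin (m + 1)) (q : Lang α) (σ τ : α)
      (h : PStep ρ (p k, σ) (q, τ)) :
      PStep ρ (.par p, σ) (.par (Function.update p k q), τ)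
  | par_skip {m : ℕ} (p : Fin (m + 1) → Lang α) (σ : α) (h : ∀ k, p k = .skip) :
      PStep ρ (.par p, σ) (.skip, σ)

/-- Finitely many (possibly zero) program steps. -/
inductive PSteps {α : Type u} (ρ : ℕ → Lang α) : Config α → Config α → Prop
  | refl (c : Config α) : PSteps ρ c c
  | head (c d e : Config α) (h : PStep ρ c d) (hs : PSteps ρ d e) : PSteps ρ c e

end

theorem PSteps.iff_reflTransGen {α : Type u} (ρ : ℕ → Lang α) (c d : Config α) :
    PSteps ρ c d ↔ Relation.ReflTransGen (PStep ρ) c d := by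
  constructor
  · exact go c d
  · intro h
    induction h using Relation.ReflTransGen.head_induction_on with
    | refl => exact .refl _
    | head h _ ih => exact .head _ _ _ h ih
where
  go : ∀ c d : Config α, PSteps ρ c d → Relation.ReflTransGen (PStep ρ) c d
    | _, _, .refl _ => .refl
    | _, _, .head _ _ _ h hs => .head h (go _ _ hs)

/-- Environment steps: the program part is unchanged, the state part is arbitrary. -/
def EStep {α : Type u} (c d : Config α) : Prop := c.1 = d.1

/-- `X` is a simulation w.r.t. `ρ`, `ρ₂` and the relation `r` on the underlying states. -/
def IsSimulation {α : Type u} {β : Type v} (ρ : ℕ → Lang α) (ρ₂ : ℕ → Lang β)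
    (r : α → β → Prop) (X : Lang α → Lang β → Prop) : Prop :=
  (∀ p q σ₁ σ₂, X p q → r σ₁ σ₂ → ∀ q₁ τ₂, PStep ρ₂ (q, σ₂) (q₁, τ₂) →
      ∃ p₁ τ₁, PStep ρ (p, σ₁) (p₁, τ₁) ∧ X p₁ q₁ ∧ r τ₁ τ₂) ∧
  (∀ q, X .skip q → q = .skip) ∧
  (∀ p, X p .skip → p = .skip)

/-- The programs `(ρ, p)` and `(ρ₂, q)` correspond w.r.t. `r`. -/
def Corresponds {α : Type u} {β : Type v} (ρ : ℕ → Lang α) (ρ₂ : ℕ → Lang β)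
    (r : α → β → Prop) (p : Lang α) (q : Lang β) : Prop :=
  ∃ X : Lang α → Lang β → Prop, X p q ∧ IsSimulation ρ ρ₂ r X

/-- `sq` is a finite potential computation of `(ρ, p)`, of length `n + 1`. -/
def IsComp {α : Type u} (ρ : ℕ → Lang α) (p : Lang α) {n : ℕ} (sq : Fin (n + 1) → Config α) :
    Prop :=
  (sq 0).1 = p ∧
    ∀ i : Fin n, PStep ρ (sq i.castSucc) (sq i.succ) ∨ EStep (sq i.castSucc) (sq i.succ)

/-- The environment condition: all environment steps of `sq` are in `R`. -/
def EnvC {α : Type u} (R : α → α → Prop) {n : ℕ} (sq : Fin (n + 1) → Config α) : Prop :=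
  ∀ i : Fin n, EStep (sq i.castSucc) (sq i.succ) → R (sq i.castSucc).2 (sq i.succ).2

/-- The program condition: all program steps of `sq` are in `G`. -/
def ProgC {α : Type u} (ρ : ℕ → Lang α) (G : α → α → Prop) {n : ℕ}
    (sq : Fin (n + 1) → Config α) : Prop :=
  ∀ i : Fin n, PStep ρ (sq i.castSucc) (sq i.succ) → G (sq i.castSucc).2 (sq i.succ).2

/-- The input condition: the initial state satisfies `P`. -/
def InC {α : Type u} (P : Set α) {n : ℕ} (sq : Fin (n + 1) → Config α) : Prop :=
  (sq 0).2 ∈ P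

/-- The output condition: the state of the first `skip`-configuration, if there is one,
satisfies `Q`. -/
def OutC {α : Type u} (Q : Set α) {n : ℕ} (sq : Fin (n + 1) → Config α) : Prop :=
  ∀ i, (sq i).1 = .skip → (∀ j, j < i → (sq j).1 ≠ .skip) → (sq i).2 ∈ Q

/-- The extended Hoare triple `ρ ⊨ {R, P} p {Q, G}` with rely `R`, precondition `P`,
postcondition `Q` and guarantee `G`. -/
def RGValid {α : Type u} (ρ : ℕ → Lang α) (R : α → α → Prop) (P : Set α) (p : Lang α)
    (Q : Set α) (G : α → α → Prop) : Prop :=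
  ∀ (n : ℕ) (sq : Fin (n + 1) → Config α),
    EnvC R sq → InC P sq → IsComp ρ p sq → OutC Q sq ∧ ProgC ρ G sq

/-- The states of the mutual exclusion algorithm; the types of `shared`, `local0` and `local1`
are left open. -/
@[ext]
structure MState (S : Type u) (L0 : Type v) (L1 : Type w) where
  flag0 : Bool
  flag1 : Bool
  turn : Bool
  turnAux0 : Bool
  turnAux1 : Bool
  shared : S
  local0 : L0
  local1 : L1

namespace MState

variable {S : Type u} {L0 : Type v} {L1 : Type w}

/-- `flag0 ∧ (¬turn_aux1 ∨ ¬flag1 ∨ ¬turn)` -/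
def cond0 (σ : MState S L0 L1) : Prop :=
  σ.flag0 = true ∧ (σ.turnAux1 = false ∨ σ.flag1 = false ∨ σ.turn = false)

/-- `flag1 ∧ (¬turn_aux0 ∨ ¬flag0 ∨ turn)` -/
def cond1 (σ : MState S L0 L1) : Prop :=
  σ.flag1 = true ∧ (σ.turnAux0 = false ∨ σ.flag0 = false ∨ σ.turn = true)

/-- The coreflexive relation `r_0`. -/
def r0 (σ τ : MState S L0 L1) : Prop := σ = τ ∧ σ.turnAux0 = true ∧ σ.cond0

/-- The coreflexive relation `r_1`. -/
def r1 (σ τ : MState S L0 L1) : Prop := σ = τ ∧ σ.turnAux1 = true ∧ σ.cond1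

/-- Equality of states up to the values of the auxiliary variables. -/
def rEqv (σ τ : MState S L0 L1) : Prop :=
  σ.flag0 = τ.flag0 ∧ σ.flag1 = τ.flag1 ∧ σ.turn = τ.turn ∧
    σ.shared = τ.shared ∧ σ.local0 = τ.local0 ∧ σ.local1 = τ.local1

/-- The rely of the first critical section. -/
def rely0 (σ τ : MState S L0 L1) : Prop := σ.shared = τ.shared ∧ σ.local0 = τ.local0

/-- The rely of the second critical section. -/
def rely1 (σ τ : MState S L0 L1) : Prop := σ.shared = τ.shared ∧ σ.local1 = τ.local1

/-- The guarantee `G_0` of the first critical section. -/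
def guar0 (P1 Q1 : S → Prop) (σ τ : MState S L0 L1) : Prop :=
  σ.flag0 = τ.flag0 ∧ σ.flag1 = τ.flag1 ∧ σ.turn = τ.turn ∧
    σ.local1 = τ.local1 ∧ σ.turnAux0 = τ.turnAux0 ∧ σ.turnAux1 = τ.turnAux1 ∧
    (P1 σ.shared → P1 τ.shared) ∧ (Q1 σ.shared → Q1 τ.shared)

/-- The guarantee `G_1` of the second critical section. -/
def guar1 (P0 Q0 : S → Prop) (σ τ : MState S L0 L1) : Prop :=
  σ.flag0 = τ.flag0 ∧ σ.flag1 = τ.flag1 ∧ σ.turn = τ.turn ∧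
    σ.local0 = τ.local0 ∧ σ.turnAux0 = τ.turnAux0 ∧ σ.turnAux1 = τ.turnAux1 ∧
    (P0 σ.shared → P0 τ.shared) ∧ (Q0 σ.shared → Q0 τ.shared)

end MState

/-- The first thread: `flag0 := True; turn := True; while flag1 ∧ turn do skip; cs; flag0 := False`. -/
def thread0 {S : Type u} {L0 : Type v} {L1 : Type w} (cs : Lang (MState S L0 L1)) :
    Lang (MState S L0 L1) :=
  .seq (.basic fun σ => { σ with flag0 := true }) <|
  .seq (.basic fun σ => { σ with turn := true }) <|
  .seq (.whileS {σ | σ.flag1 = true ∧ σ.turn = true} .skip) <|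
  .seq cs <|
  .basic fun σ => { σ with flag0 := false }

/-- The second thread:
`flag1 := True; turn := False; while flag0 ∧ ¬turn do skip; cs; flag1 := False`. -/
def thread1 {S : Type u} {L0 : Type v} {L1 : Type w} (cs : Lang (MState S L0 L1)) :
    Lang (MState S L0 L1) :=
  .seq (.basic fun σ => { σ with flag1 := true }) <|
  .seq (.basic fun σ => { σ with turn := false }) <|
  .seq (.whileS {σ | σ.flag0 = true ∧ σ.turn = false} .skip) <|
  .seq cs <|
  .basic fun σ => { σ with flag1 := false }

-- The proof is an invariant argument over pairs of control stages. The stage of a thread tells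
-- whether it has assigned `turn` yet (`Stage.Early`), which is the information that `turnAux0` and
-- `turnAux1` stand for in `cond0` and `cond1`. A thread past its loop knows that the other one is
-- early, or has its flag down, or that `turn` has the value that lets the first one through. Were
-- both past their loops, neither would be early, both flags would be up, and `turn` would be both
-- true and false. So while one critical section changes `shared`, the other is not running, and its
-- rely is never violated; the guarantees keep the other thread's pre- or postcondition true.
--
-- `Reach.post` and `Reach.guarantee` turn the triples for the critical sections into stepwise
-- facts, `ThreadAt.step` and `ThreadAt.env` follow one thread, `PetersonInv.move0` and
-- `PetersonInv.move1` preserve the invariant, and `Running.step` combines these.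

-- Computations as reachable configurations

/-- A program step that does not change the program part does not change the state either. -/
theorem PStep.state_eq_of_prog_eq {α : Type u} {ρ : ℕ → Lang α} {p : Lang α} :
    ∀ {q : Lang α} {σ τ : α}, PStep ρ (p, σ) (q, τ) → p = q → σ = τ := by
  induction p with
  | skip => intro q σ τ h; cases h
  | basic f => intro q σ τ h e; cases h; cases e
  | cjump C i p _ => intro q σ τ h _; cases h <;> rfl
  | whileDo C p q _ _ => intro q σ τ h _; cases h <;> rfl
  | ite C p q _ _ => intro q σ τ h _; cases h <;> rfl
  | await C p _ => intro q σ τ h e; cases h; cases e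
  | seq p q ihp _ =>
    intro r σ τ h e
    cases h with
    | seq _ p₂ _ _ _ h => exact ihp h (Lang.seq.inj e).1
    | seq_skip => rfl
  | par p ih =>
    intro r σ τ h e
    cases h with
    | par _ k q _ _ h =>
      have e' := eq_of_heq (Lang.par.inj e).2
      refine ih k h ?_
      -- Updating `p` at `k` gives back `p` only if the new component equals `p k`.
      conv_lhs => rw [e']
      simp
    | par_skip => rfl

/-- Configurations reached by computations of `p` that start in `P`, whose environment steps
are in `R`, and that do not continue after `skip`. -/
inductive Reach {α : Type u} (ρ : ℕ → Lang α) (R : α → α → Prop) (P : Set α) (p : Lang α) :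
    Lang α → α → Prop
  | init (σ : α) (h : σ ∈ P) : Reach ρ R P p p σ
  | prog (u v : Lang α) (σ τ : α) (h : Reach ρ R P p u σ) (hu : u ≠ .skip)
      (hs : PStep ρ (u, σ) (v, τ)) : Reach ρ R P p v τ
  | env (u : Lang α) (σ τ : α) (h : Reach ρ R P p u σ) (hu : u ≠ .skip)
      (hs : R σ τ) : Reach ρ R P p u τ

namespace Reach

variable {α : Type u} {ρ : ℕ → Lang α} {R : α → α → Prop} {P : Set α} {p : Lang α}

/-- Extending a computation by one step. -/
theorem snoc_comp {n : ℕ} {sq : Fin (n + 1) → Config α} {d : Config α}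
    (henv : EnvC R sq) (hin : InC P sq) (hcomp : IsComp ρ p sq)
    (hstep : PStep ρ (sq (Fin.last n)) d ∨ EStep (sq (Fin.last n)) d)
    (hR : EStep (sq (Fin.last n)) d → R (sq (Fin.last n)).2 d.2) :
    let sq' : Fin (n + 1 + 1) → Config α := Fin.snoc (α := fun _ => Config α) sq d
    EnvC R sq' ∧ InC P sq' ∧ IsComp ρ p sq' := by
  intro sq'
  have h0 : sq' 0 = sq 0 := Fin.snoc_castSucc (α := fun _ => Config α) (n := n + 1) d sq 0
  have hc : ∀ i : Fin (n + 1), sq' i.castSucc = sq i := fun i =>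
    Fin.snoc_castSucc (α := fun _ => Config α) d sq i
  have hl : sq' (Fin.last (n + 1)) = d := Fin.snoc_last (α := fun _ => Config α) d sq
  refine ⟨?_, ?_, ?_, ?_⟩
  · intro i
    induction i using Fin.lastCases with
    | last => rw [hc, Fin.succ_last, hl]; exact hR
    | cast i => rw [hc, Fin.succ_castSucc, hc]; exact henv i
  · unfold InC; rw [h0]; exact hin
  · rw [h0]; exact hcomp.1
  · intro i
    induction i using Fin.lastCases with
    | last => rw [hc, Fin.succ_last, hl]; exact hstep
    | cast i => rw [hc, Fin.succ_castSucc, hc]; exact hcomp.2 i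

/-- Reflexivity of `R` is needed because `EStep` compares program parts only: a program step that
loops, such as a jump to itself, also counts as an environment step. It leaves the state fixed, so
`R` holds there. -/
theorem exists_comp (hrefl : ∀ σ, R σ σ) {u : Lang α} {σ : α} (h : Reach ρ R P p u σ) :
    ∃ (n : ℕ) (sq : Fin (n + 1) → Config α), EnvC R sq ∧ InC P sq ∧ IsComp ρ p sq ∧
      (∀ i : Fin n, (sq i.castSucc).1 ≠ .skip) ∧ sq (Fin.last n) = (u, σ) := by
  have extend : ∀ {u v : Lang α} {σ τ : α}, u ≠ .skip →
      (PStep ρ (u, σ) (v, τ) ∨ EStep (u, σ) (v, τ)) → (EStep (u, σ) (v, τ) → R σ τ) →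
      (∃ (n : ℕ) (sq : Fin (n + 1) → Config α), EnvC R sq ∧ InC P sq ∧ IsComp ρ p sq ∧
        (∀ i : Fin n, (sq i.castSucc).1 ≠ .skip) ∧ sq (Fin.last n) = (u, σ)) →
      ∃ (n : ℕ) (sq : Fin (n + 1) → Config α), EnvC R sq ∧ InC P sq ∧ IsComp ρ p sq ∧
        (∀ i : Fin n, (sq i.castSucc).1 ≠ .skip) ∧ sq (Fin.last n) = (v, τ) := by
    rintro u v σ τ hu hstep hR ⟨n, sq, henv, hin, hcomp, hne, hlast⟩
    obtain ⟨a, b, c⟩ := snoc_comp (d := (v, τ)) henv hin hcomp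
      (by rwa [hlast]) (by rwa [hlast])
    refine ⟨n + 1, _, a, b, c, ?_, Fin.snoc_last (α := fun _ => Config α) _ _⟩
    intro i
    rw [Fin.snoc_castSucc (α := fun _ => Config α)]
    induction i using Fin.lastCases with
    | last => rw [hlast]; exact hu
    | cast i => exact hne i
  induction h with
  | init σ h =>
    exact ⟨0, fun _ => (p, σ), fun i => i.elim0, h, ⟨rfl, fun i => i.elim0⟩,
      fun i => i.elim0, rfl⟩
  | prog u v σ τ _ hu hs ih =>
    exact extend hu (.inl hs) (fun e => by
      obtain rfl := hs.state_eq_of_prog_eq e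
      exact hrefl σ) ih
  | env u σ τ _ hu hs ih => exact extend (σ := σ) (τ := τ) hu (.inr rfl) (fun _ => hs) ih

variable {Q : Set α} {G : α → α → Prop}

theorem post (hv : RGValid ρ R P p Q G) (hrefl : ∀ σ, R σ σ) {σ : α}
    (h : Reach ρ R P p .skip σ) : σ ∈ Q := by
  obtain ⟨n, sq, henv, hin, hcomp, hne, hlast⟩ := h.exists_comp hrefl
  -- `Reach` never continues after `skip`, so the last configuration is the first
  -- `skip`-configuration.
  have := (hv n sq henv hin hcomp).1 (Fin.last n) (by rw [hlast]) (fun j hj => by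
    obtain ⟨i, rfl⟩ := Fin.exists_castSucc_eq.2 hj.ne
    exact hne i)
  rwa [hlast] at this

theorem guarantee (hv : RGValid ρ R P p Q G) (hrefl : ∀ σ, R σ σ) {u v : Lang α} {σ τ : α}
    (h : Reach ρ R P p u σ) (hs : PStep ρ (u, σ) (v, τ)) : G σ τ := by
  obtain ⟨n, sq, henv, hin, hcomp, -, hlast⟩ := h.exists_comp hrefl
  obtain ⟨a, b, c⟩ := snoc_comp (d := (v, τ)) henv hin hcomp
    (.inl (by rwa [hlast])) (fun e => by
      rw [hlast] at e ⊢
      obtain rfl := hs.state_eq_of_prog_eq e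
      exact hrefl σ)
  have := (hv _ _ a b c).2 (Fin.last n)
  rw [Fin.snoc_castSucc (α := fun _ => Config α), Fin.succ_last,
    Fin.snoc_last (α := fun _ => Config α), hlast] at this
  exact this hs

end Reach

-- Stages and assertions of a single thread

/-- The stages a thread of the mutual exclusion algorithm passes through. -/
inductive Stage
  | idle | flagged | waiting | ready | crit | leaving | done

namespace Stage

/-- The thread has not yet assigned `turn`. -/
def Early : Stage → Prop
  | idle | flagged => True
  | _ => False

/-- The flag of the thread is set. -/
def Flagged : Stage → Prop
  | idle | done => False
  | _ => True

/-- The thread is past the waiting loop, with its flag still set. -/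
def Critical : Stage → Prop
  | ready | crit | leaving => True
  | _ => False

end Stage

section Thread

variable {α : Type u} (ρ : ℕ → Lang α) (R : α → α → Prop) (P Q : Set α) (G : α → α → Prop)
  (f t e : α → α) (C : Set α) (cs : Lang α)

/-- `ThreadAt … s p σ`: the remaining program `p` of the thread
`f; t; while C do skip; cs; e` is in stage `s`, with the assertions about `σ` due there. -/
inductive ThreadAt : Stage → Lang α → α → Prop
  | idle (σ : α) (h : σ ∈ P) : ThreadAt .idle
      (.seq (.basic f) (.seq (.basic t) (.seq (.whileS C .skip) (.seq cs (.basic e))))) σ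
  | flagged_skip (σ : α) (h : σ ∈ P) : ThreadAt .flagged
      (.seq .skip (.seq (.basic t) (.seq (.whileS C .skip) (.seq cs (.basic e))))) σ
  | flagged (σ : α) (h : σ ∈ P) : ThreadAt .flagged
      (.seq (.basic t) (.seq (.whileS C .skip) (.seq cs (.basic e)))) σ
  | waiting_skip (σ : α) (h : σ ∈ P) : ThreadAt .waiting
      (.seq .skip (.seq (.whileS C .skip) (.seq cs (.basic e)))) σ
  | waiting (σ : α) (h : σ ∈ P) : ThreadAt .waiting
      (.seq (.whileS C .skip) (.seq cs (.basic e))) σ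
  | waiting_body (σ : α) (h : σ ∈ P) : ThreadAt .waiting
      (.seq (.seq .skip (.seq .skip (.whileS C .skip))) (.seq cs (.basic e))) σ
  | waiting_again (σ : α) (h : σ ∈ P) : ThreadAt .waiting
      (.seq (.seq .skip (.whileS C .skip)) (.seq cs (.basic e))) σ
  | ready (σ : α) (h : σ ∈ P) : ThreadAt .ready (.seq .skip (.seq cs (.basic e))) σ
  | crit (u : Lang α) (σ : α) (hu : u ≠ .skip) (h : Reach ρ R P cs u σ) :
      ThreadAt .crit (.seq u (.basic e)) σ
  | leaving_skip (σ : α) (h : σ ∈ Q) : ThreadAt .leaving (.seq .skip (.basic e)) σ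
  | leaving (σ : α) (h : σ ∈ Q) : ThreadAt .leaving (.basic e) σ
  | done (σ : α) (h : σ ∈ Q) : ThreadAt .done .skip σ

/-- The effect of a program step of a thread on its stage and on the state. -/
inductive Move : Stage → Stage → α → α → Prop
  | raise (σ : α) : Move .idle .flagged σ (f σ)
  | yield (σ : α) : Move .flagged .waiting σ (t σ)
  | exit (σ : α) (h : σ ∉ C) : Move .waiting .ready σ σ
  | enter (σ : α) : Move .ready .crit σ σ
  | enter_skip (σ : α) : Move .ready .leaving σ σ
  | inner (σ τ : α) (h : G σ τ) : Move .crit .crit σ τ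
  | finish (σ τ : α) (h : G σ τ) : Move .crit .leaving σ τ
  | lower (σ : α) : Move .leaving .done σ (e σ)
  | stutter (s : Stage) (σ : α) : Move s s σ σ

variable {ρ R P Q G f t e C cs}

theorem ThreadAt.env {s : Stage} {p : Lang α} {σ τ : α}
    (h : ThreadAt ρ R P Q f t e C cs s p σ) (hR : s = .crit → R σ τ)
    (hP : σ ∈ P → τ ∈ P) (hQ : σ ∈ Q → τ ∈ Q) : ThreadAt ρ R P Q f t e C cs s p τ := by
  cases h with
  | idle _ h => exact .idle _ (hP h)
  | flagged_skip _ h => exact .flagged_skip _ (hP h)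
  | flagged _ h => exact .flagged _ (hP h)
  | waiting_skip _ h => exact .waiting_skip _ (hP h)
  | waiting _ h => exact .waiting _ (hP h)
  | waiting_body _ h => exact .waiting_body _ (hP h)
  | waiting_again _ h => exact .waiting_again _ (hP h)
  | ready _ h => exact .ready _ (hP h)
  | crit u _ hu h => exact .crit u _ hu (.env _ _ _ h hu (hR rfl))
  | leaving_skip _ h => exact .leaving_skip _ (hQ h)
  | leaving _ h => exact .leaving _ (hQ h)
  | done _ h => exact .done _ (hQ h)

/-- Abstracts program syntax away: afterwards only the finitely many kinds of `Move` matter for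
interference. -/
theorem ThreadAt.step {s : Stage} {p q : Lang α} {σ τ : α}
    (h : ThreadAt ρ R P Q f t e C cs s p σ) (hv : RGValid ρ R P cs Q G) (hrefl : ∀ σ, R σ σ)
    (hf : ∀ σ ∈ P, f σ ∈ P) (ht : ∀ σ ∈ P, t σ ∈ P) (he : ∀ σ ∈ Q, e σ ∈ Q)
    (hs : PStep ρ (p, σ) (q, τ)) :
    ∃ s', Move G f t e C s s' σ τ ∧ ThreadAt ρ R P Q f t e C cs s' q τ := by
  cases h with
  | idle _ h =>
    cases hs with | seq _ _ _ _ _ hs =>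
    cases hs
    exact ⟨_, .raise _, .flagged_skip _ (hf _ h)⟩
  | flagged_skip _ h =>
    cases hs with
    | seq _ _ _ _ _ hs => cases hs
    | seq_skip => exact ⟨_, .stutter _ _, .flagged _ h⟩
  | flagged _ h =>
    cases hs with | seq _ _ _ _ _ hs =>
    cases hs
    exact ⟨_, .yield _, .waiting_skip _ (ht _ h)⟩
  | waiting_skip _ h =>
    cases hs with
    | seq _ _ _ _ _ hs => cases hs
    | seq_skip => exact ⟨_, .stutter _ _, .waiting _ h⟩
  | waiting _ h =>
    cases hs with | seq _ _ _ _ _ hs =>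
    cases hs with
    | while_true => exact ⟨_, .stutter _ _, .waiting_body _ h⟩
    | while_false _ _ _ _ hC => exact ⟨_, .exit _ hC, .ready _ h⟩
  | waiting_body _ h =>
    cases hs with | seq _ _ _ _ _ hs =>
    cases hs with
    | seq _ _ _ _ _ hs => cases hs
    | seq_skip => exact ⟨_, .stutter _ _, .waiting_again _ h⟩
  | waiting_again _ h =>
    cases hs with | seq _ _ _ _ _ hs =>
    cases hs with
    | seq _ _ _ _ _ hs => cases hs
    | seq_skip => exact ⟨_, .stutter _ _, .waiting _ h⟩
  | ready _ h =>
    cases hs with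
    | seq _ _ _ _ _ hs => cases hs
    | seq_skip =>
      have hr : Reach ρ R P cs cs σ := .init _ h
      -- The stage `crit` excludes `skip`, so that `Reach` can absorb interference there; an empty
      -- critical section passes directly to `leaving`.
      by_cases hc : cs = .skip
      · have hq : σ ∈ Q := Reach.post hv hrefl (by rwa [← hc])
        refine ⟨_, .enter_skip _, ?_⟩
        have := ThreadAt.leaving_skip (ρ := ρ) (R := R) (P := P) (f := f) (t := t) (e := e)
          (C := C) (cs := cs) σ hq
        rwa [← hc] at this
      · exact ⟨_, .enter _, .crit _ _ hc hr⟩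
  | crit u _ hu h =>
    cases hs with
    | seq _ v _ _ _ hs =>
      have hr : Reach ρ R P cs v τ := .prog _ _ _ _ h hu hs
      have hg := h.guarantee hv hrefl hs
      by_cases hc : v = .skip
      · subst hc
        exact ⟨_, .finish _ _ hg, .leaving_skip _ (hr.post hv hrefl)⟩
      · exact ⟨_, .inner _ _ hg, .crit _ _ hc hr⟩
    | seq_skip => exact absurd rfl hu
  | leaving_skip _ h =>
    cases hs with
    | seq _ _ _ _ _ hs => cases hs
    | seq_skip => exact ⟨_, .stutter _ _, .leaving _ h⟩
  | leaving _ h =>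
    cases hs
    exact ⟨_, .lower _, .done _ (he _ h)⟩
  | done _ h => cases hs

theorem ThreadAt.post_of_skip {s : Stage} {σ : α}
    (h : ThreadAt ρ R P Q f t e C cs s .skip σ) : σ ∈ Q := by
  cases h with
  | done _ h => exact h

end Thread

-- The invariant of the two threads and their parallel composition

section Peterson

variable {S : Type u} {L0 : Type v} {L1 : Type w}

/-- The invariant of Peterson's algorithm, for threads in stages `s₀` and `s₁`. -/
structure PetersonInv (s₀ s₁ : Stage) (σ : MState S L0 L1) : Prop where
  flag0 : s₀.Flagged → σ.flag0 = true
  flag1 : s₁.Flagged → σ.flag1 = true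
  cond0 : s₀.Critical → s₁.Early ∨ σ.flag1 = false ∨ σ.turn = false
  cond1 : s₁.Critical → s₀.Early ∨ σ.flag0 = false ∨ σ.turn = true

variable {P0 Q0 P1 Q1 : S → Prop} {s₀ s₁ s' : Stage} {σ τ : MState S L0 L1}

/-- Leaving the loop establishes `cond0` by the negated loop test. Assigning `turn` ends the early
phase, but gives `turn` the value that `cond1` asks for. -/
theorem PetersonInv.move0 (h : PetersonInv s₀ s₁ σ)
    (hm : Move (MState.guar0 P1 Q1) (fun σ => { σ with flag0 := true })
      (fun σ => { σ with turn := true }) (fun σ => { σ with flag0 := false })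
      {σ | σ.flag1 = true ∧ σ.turn = true} s₀ s' σ τ) :
    PetersonInv s' s₁ τ ∧ (s₁ = .crit → MState.rely1 σ τ) ∧
      (P1 σ.shared → P1 τ.shared) ∧ (Q1 σ.shared → Q1 τ.shared) := by
  obtain ⟨h1, h2, h3, h4⟩ := h
  cases hm with
  | inner _ _ hg | finish _ _ hg =>
    obtain ⟨g1, g2, g3, g4, g5, g6, g7, g8⟩ := hg
    refine ⟨⟨?_, ?_, ?_, ?_⟩, ?_, g7, g8⟩
    -- The guarantee fixes flags and `turn`. The rely in the case `s₁ = .crit` holds vacuously: both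
    -- threads would be critical.
    all_goals cases s₁ <;> simp_all [Stage.Flagged, Stage.Critical, Stage.Early]
  | _ =>
    refine ⟨⟨?_, ?_, ?_, ?_⟩, fun _ => ⟨rfl, rfl⟩, id, id⟩
    all_goals
      cases s₁ <;> simp_all [Stage.Flagged, Stage.Critical, Stage.Early] <;> grind

theorem PetersonInv.move1 (h : PetersonInv s₀ s₁ σ)
    (hm : Move (MState.guar1 P0 Q0) (fun σ => { σ with flag1 := true })
      (fun σ => { σ with turn := false }) (fun σ => { σ with flag1 := false })
      {σ | σ.flag0 = true ∧ σ.turn = false} s₁ s' σ τ) :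
    PetersonInv s₀ s' τ ∧ (s₀ = .crit → MState.rely0 σ τ) ∧
      (P0 σ.shared → P0 τ.shared) ∧ (Q0 σ.shared → Q0 τ.shared) := by
  obtain ⟨h1, h2, h3, h4⟩ := h
  cases hm with
  | inner _ _ hg | finish _ _ hg =>
    obtain ⟨g1, g2, g3, g4, g5, g6, g7, g8⟩ := hg
    refine ⟨⟨?_, ?_, ?_, ?_⟩, ?_, g7, g8⟩
    all_goals cases s₀ <;> simp_all [Stage.Flagged, Stage.Critical, Stage.Early]
  | _ =>
    refine ⟨⟨?_, ?_, ?_, ?_⟩, fun _ => ⟨rfl, rfl⟩, id, id⟩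
    all_goals
      cases s₀ <;> simp_all [Stage.Flagged, Stage.Critical, Stage.Early] <;> grind

/-- The first thread is in stage `s`, with remaining program `p`. -/
abbrev Thread0At (ρ : ℕ → Lang (MState S L0 L1)) (P0 Q0 : S → Prop)
    (cs0 : Lang (MState S L0 L1)) : Stage → Lang (MState S L0 L1) → MState S L0 L1 → Prop :=
  ThreadAt ρ MState.rely0 {σ | P0 σ.shared} {σ | Q0 σ.shared}
    (fun σ => { σ with flag0 := true }) (fun σ => { σ with turn := true })
    (fun σ => { σ with flag0 := false }) {σ | σ.flag1 = true ∧ σ.turn = true} cs0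

/-- The second thread is in stage `s`, with remaining program `p`. -/
abbrev Thread1At (ρ : ℕ → Lang (MState S L0 L1)) (P1 Q1 : S → Prop)
    (cs1 : Lang (MState S L0 L1)) : Stage → Lang (MState S L0 L1) → MState S L0 L1 → Prop :=
  ThreadAt ρ MState.rely1 {σ | P1 σ.shared} {σ | Q1 σ.shared}
    (fun σ => { σ with flag1 := true }) (fun σ => { σ with turn := false })
    (fun σ => { σ with flag1 := false }) {σ | σ.flag0 = true ∧ σ.turn = false} cs1

/-- The invariant of the parallel composition of the two threads before its termination. -/
def Running (ρ : ℕ → Lang (MState S L0 L1)) (P0 Q0 P1 Q1 : S → Prop)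
    (cs0 cs1 : Lang (MState S L0 L1)) (c : Config (MState S L0 L1)) : Prop :=
  ∃ p q s₀ s₁, c.1 = Lang.par2 p q ∧ PetersonInv s₀ s₁ c.2 ∧
    Thread0At ρ P0 Q0 cs0 s₀ p c.2 ∧ Thread1At ρ P1 Q1 cs1 s₁ q c.2

variable {ρ : ℕ → Lang (MState S L0 L1)} {cs0 cs1 : Lang (MState S L0 L1)}

theorem PStep.par2_cases {α : Type u} {ρ : ℕ → Lang α} {p q r : Lang α} {σ τ : α}
    (h : PStep ρ (Lang.par2 p q, σ) (r, τ)) :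
    (∃ p', r = Lang.par2 p' q ∧ PStep ρ (p, σ) (p', τ)) ∨
      (∃ q', r = Lang.par2 p q' ∧ PStep ρ (q, σ) (q', τ)) ∨
      (p = .skip ∧ q = .skip ∧ r = .skip ∧ τ = σ) := by
  unfold Lang.par2 at h ⊢
  cases h with
  | par _ k u _ _ h =>
    fin_cases k
    · exact .inl ⟨u, by congr 1; ext i; fin_cases i <;> rfl, h⟩
    · exact .inr (.inl ⟨u, by congr 1; ext i; fin_cases i <;> rfl, h⟩)
  | par_skip _ _ h => exact .inr (.inr ⟨h 0, h 1, rfl, rfl⟩)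

/-- Each step of one thread is a `Move`, which the other thread sees as interference allowed by its
rely when it is in `crit`, and preserving its assertions otherwise. -/
theorem Running.step
    (h1 : RGValid ρ MState.rely0 {σ | P0 σ.shared} cs0 {σ | Q0 σ.shared} (MState.guar0 P1 Q1))
    (h2 : RGValid ρ MState.rely1 {σ | P1 σ.shared} cs1 {σ | Q1 σ.shared} (MState.guar1 P0 Q0))
    {c d : Config (MState S L0 L1)} (h : Running ρ P0 Q0 P1 Q1 cs0 cs1 c) (hs : PStep ρ c d) :
    Running ρ P0 Q0 P1 Q1 cs0 cs1 d ∨ d.1 = .skip ∧ Q0 d.2.shared ∧ Q1 d.2.shared := by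
  obtain ⟨c, σ⟩ := c
  obtain ⟨d, τ⟩ := d
  obtain ⟨p, q, s₀, s₁, rfl, hI, ha, hb⟩ := h
  rcases hs.par2_cases with ⟨p', rfl, hp⟩ | ⟨q', rfl, hq⟩ | ⟨rfl, rfl, rfl, rfl⟩
  · obtain ⟨s', hm, ha'⟩ := ha.step h1 (fun _ => ⟨rfl, rfl⟩) (fun _ h => h) (fun _ h => h)
      (fun _ h => h) hp
    obtain ⟨hI', hR, hP, hQ⟩ := hI.move0 hm
    exact .inl ⟨p', q, s', s₁, rfl, hI', ha', hb.env hR hP hQ⟩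
  · obtain ⟨s', hm, hb'⟩ := hb.step h2 (fun _ => ⟨rfl, rfl⟩) (fun _ h => h) (fun _ h => h)
      (fun _ h => h) hq
    obtain ⟨hI', hR, hP, hQ⟩ := hI.move1 hm
    exact .inl ⟨p, q', s₀, s', rfl, hI', ha.env hR hP hQ, hb'⟩
  · exact .inr ⟨rfl, ha.post_of_skip, hb.post_of_skip⟩

end Peterson

theorem mainTheorem5 {S : Type u} {L0 : Type v} {L1 : Type w}
    (ρ : ℕ → Lang (MState S L0 L1))
    (P0 Q0 P1 Q1 : S → Prop)
    (cs0 cs1 : Lang (MState S L0 L1))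
    (h1 : RGValid ρ MState.rely0 {σ | P0 σ.shared} cs0 {σ | Q0 σ.shared} (MState.guar0 P1 Q1))
    (h2 : RGValid ρ MState.rely1 {σ | P1 σ.shared} cs1 {σ | Q1 σ.shared} (MState.guar1 P0 Q0))
    (h3 : Corresponds ρ ρ MState.r0 cs0 cs0)
    (h4 : Corresponds ρ ρ MState.r1 cs1 cs1)
    (h5 : Corresponds ρ ρ MState.rEqv cs0 cs0)
    (h6 : Corresponds ρ ρ MState.rEqv cs1 cs1) :
    RGValid ρ Eq {σ | P0 σ.shared ∧ P1 σ.shared}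
      (Lang.par2 (thread0 cs0) (thread1 cs1))
      {σ | Q0 σ.shared ∧ Q1 σ.shared} ⊤ := by
  intro n sq henv hin hcomp
  refine ⟨?_, fun _ _ => trivial⟩
  have key : ∀ i : Fin (n + 1), Running ρ P0 Q0 P1 Q1 cs0 cs1 (sq i) ∨
      (sq i).1 = .skip ∧ Q0 (sq i).2.shared ∧ Q1 (sq i).2.shared := by
    intro i
    induction i using Fin.induction with
    | zero =>
      -- The initial flags and `turn` are arbitrary; at `idle` every clause of the invariant is
      -- vacuous.
      exact .inl ⟨_, _, .idle, .idle, hcomp.1, ⟨False.elim, False.elim, False.elim, False.elim⟩,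
        .idle _ hin.1, .idle _ hin.2⟩
    | succ i ih =>
      rcases hcomp.2 i with hs | hs
      · rcases ih with ih | ⟨ih, -⟩
        · exact ih.step h1 h2 hs
        · rw [← Prod.mk.eta (p := sq i.castSucc), ih] at hs
          cases hs
      -- The rely is equality, so environment steps change nothing.
      · have : sq i.succ = sq i.castSucc := (Prod.ext hs (henv i hs)).symm
        rwa [this]
  intro i hi _
  rcases key i with ⟨p, q, _, _, h, _⟩ | ⟨-, h⟩
  · rw [hi] at h
    cases h
  · exact h
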